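/- Let $\Gamma\subseteq\mathbb{C}$ be such that $0\in\Gamma$ and $\Gamma\setminus\{0\}$ is a subgroup of the multiplicative group of complex numbers of modulus $1$. Let $\mathcal{H}_n(\Gamma)$ be the set of all $n\times n$ Hermitian matrices with entries in $\Gamma$ and zero diagonal. For $A=[a_{uv}]\in\mathcal{H}_n(\Gamma)$ the graph $G_A$ of $A$ is the simple graph on $\{1,\dots,n\}$ in which $u$ and $v$ are adjacent if and only if $a_{uv}\neq 0$. For a cycle $C=u_1u_2\cdots u_ku_1$ (with $k\ge 3$) in $G_A$, the gain of $C$ is $\zeta_A(C)=a_{u_1u_2}a_{u_2u_3}\cdots a_{u_{k-1}u_k}a_{u_ku_1}$ and the real gain is $\Re_A(C)=\operatorname{Re}\zeta_A(C)$ (which does not depend on the starting vertex or the direction of $C$). The matrix $A$ is balanced if $\zeta_A(C)=1$ for every cycle $C$ in $G_A$. Two matrices are cospectral if they have the same multiset of eigenvalues. Let $A,B\in\mathcal{H}_n(\Gamma)$ have the same graph $G$, that is, $G_A=G_B=G$. (1) If $\Re_A(C)\le\Re_B(C)$ for each cycle $C$ in $G$, then $A$ and $B$ are cospectral if and only if $\Re_A(C)=\Re_B(C)$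 for each cycle $C$ in $G$. (2) If $A$ is balanced, then $A$ and $B$ are cospectral if and only if $\Re_A(C)=\Re_B(C)$ for each cycle $C$ in $G$. -/

import Mathlib

/-- `Γ` is a set of complex numbers containing `0` whose nonzero elements form a subgroup of
the group of complex numbers of unit modulus. -/
def IsGainSet (Γ : Set ℂ) : Prop :=
  (0 : ℂ) ∈ Γ ∧ ∃ U : Subgroup Circle, Γ \ {0} = (fun z : Circle => (z : ℂ)) '' (U : Set Circle)

/-- The set `H_n(Γ)` of all `n × n` Hermitian matrices with entries in `Γ` and zero diagonal. -/
def hermitianGain (n : ℕ) (Γ : Set ℂ) : Set (Matrix (Fin n) (Fin n) ℂ) :=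
  {A | A.IsHermitian ∧ (∀ i j, A i j ∈ Γ) ∧ ∀ i, A i i = 0}

/-- The graph `G_A` of a matrix `A ∈ H_n(Γ)`: `u` and `v` are adjacent iff `a_{uv} ≠ 0`. -/
def graphOf {n : ℕ} {Γ : Set ℂ} (A : hermitianGain n Γ) : SimpleGraph (Fin n) where
  Adj u v := A.1 u v ≠ 0
  symm := ⟨fun u v h => by
    rw [← A.2.1.apply v u]
    exact star_ne_zero.mpr h⟩
  loopless := ⟨fun u h => h (A.2.2.2 u)⟩

/-- The gain of a walk (in particular, of a cycle, viewed as a closed walk) with respect to `A`: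
the product of the entries `a_{uv}` over the successive directed edges `(u, v)` of the walk. -/
def gain {n : ℕ} (A : Matrix (Fin n) (Fin n) ℂ) {G : SimpleGraph (Fin n)} {u v : Fin n}
    (W : G.Walk u v) : ℂ :=
  (W.darts.map fun d => A d.fst d.snd).prod

/-- The real gain of a walk with respect to `A`. -/
def realGain {n : ℕ} (A : Matrix (Fin n) (Fin n) ℂ) {G : SimpleGraph (Fin n)} {u v : Fin n}
    (W : G.Walk u v) : ℝ :=
  (gain A W).re

/-- `A` is balanced if every cycle of its graph has gain `1`. -/
def IsBalanced {n : ℕ} {Γ : Set ℂ} (A : hermitianGain n Γ) : Prop :=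
  ∀ (u : Fin n) (C : (graphOf A).Walk u u), C.IsCycle → gain A.1 C = 1

/-- The spectrum of a complex matrix: the multiset of its eigenvalues, with algebraic
multiplicities. -/
noncomputable def spectrumMultiset {n : ℕ} (A : Matrix (Fin n) (Fin n) ℂ) : Multiset ℂ :=
  A.charpoly.roots

/-- Two matrices are cospectral if they have the same multiset of eigenvalues. -/
def Cospectral {n : ℕ} (A B : Matrix (Fin n) (Fin n) ℂ) : Prop :=
  spectrumMultiset A = spectrumMultiset B

/-! Expand the characteristic polynomial over permutations. The diagonal is zero, so the coefficient
of `X ^ (n - k)` is a signed sum, over permutations moving exactly `k` points, of products of cycle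
weights. Inverting one cycle keeps support and sign and, for a Hermitian matrix, conjugates that
cycle's weight. Averaging over such inversions shows that only the real parts of cycle weights
matter (`sum_prod_cycleFactorsFinset_eq`); this is one direction.

Conversely, induct on cycle length `k`. Permutations of `k` points that are not `k`-cycles split
into shorter cycles, already settled, so equal coefficients give equal sums over `k`-cycles
(`sum_isCycle_permWeight_eq`). With termwise inequality of real parts, every term agrees. The
balanced case follows because real gain `1` is maximal. -/

open Equiv.Perm in
/-- Replacing a cycle of a permutation by its inverse changes the set of cycles accordingly. -/
theorem cycleFactorsFinset_mul_inv_mul_inv {α : Type*} [Fintype α] [DecidableEq α]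
    {σ c : Equiv.Perm α} (hc : c ∈ σ.cycleFactorsFinset) :
    (σ * c⁻¹ * c⁻¹).cycleFactorsFinset = insert c⁻¹ (σ.cycleFactorsFinset.erase c) := by
  have hd : Disjoint (σ * c⁻¹) c⁻¹ := (disjoint_mul_inv_of_mem_cycleFactorsFinset hc).inv_right
  have hcyc : c⁻¹.IsCycle := (mem_cycleFactorsFinset_iff.mp hc).1.inv
  rw [hd.cycleFactorsFinset_mul_eq_union, cycleFactorsFinset_mul_inv_mem_eq_sdiff hc,
    hcyc.cycleFactorsFinset_eq_singleton, Finset.union_comm, Finset.sdiff_singleton_eq_erase]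
  rfl

open Equiv.Perm in
-- Distinct cycle factors have disjoint supports, while `c` and `c⁻¹` share one. The erasure
-- matters: a transposition is its own inverse.
theorem inv_notMem_erase_cycleFactorsFinset {α : Type*} [Fintype α] [DecidableEq α]
    {σ c : Equiv.Perm α} (hc : c ∈ σ.cycleFactorsFinset) :
    c⁻¹ ∉ σ.cycleFactorsFinset.erase c := by
  intro h
  obtain ⟨hne, hmem⟩ := Finset.mem_erase.mp h
  have hd := (cycleFactorsFinset_pairwise_disjoint σ hmem hc hne).disjoint_support
  rw [support_inv, disjoint_self, Finset.bot_eq_empty, support_eq_empty_iff] at hd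
  exact (mem_cycleFactorsFinset_iff.mp hc).1.ne_one hd

/-- The permutation obtained from `σ` by inverting its cycle through `v`. -/
def invertCycleAt {α : Type*} [Fintype α] [DecidableEq α] (v : α) (σ : Equiv.Perm α) :
    Equiv.Perm α :=
  σ * (σ.cycleOf v)⁻¹ * (σ.cycleOf v)⁻¹

section
variable {α : Type*} [Fintype α] [DecidableEq α]
open Equiv.Perm

theorem invertCycleAt_of_notMem {v : α} {σ : Equiv.Perm α} (hv : v ∉ σ.support) :
    invertCycleAt v σ = σ := by
  have : σ.cycleOf v = 1 := (cycleOf_eq_one_iff σ).mpr (notMem_support.mp hv)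
  simp [invertCycleAt, this]

theorem cycleFactorsFinset_invertCycleAt {v : α} {σ : Equiv.Perm α} (hv : v ∈ σ.support) :
    (invertCycleAt v σ).cycleFactorsFinset =
      insert (σ.cycleOf v)⁻¹ (σ.cycleFactorsFinset.erase (σ.cycleOf v)) :=
  cycleFactorsFinset_mul_inv_mul_inv (cycleOf_mem_cycleFactorsFinset_iff.mpr hv)

theorem cycleOf_invertCycleAt {v : α} {σ : Equiv.Perm α} (hv : v ∈ σ.support) :
    (invertCycleAt v σ).cycleOf v = (σ.cycleOf v)⁻¹ := by
  symm
  apply cycle_is_cycleOf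
  · rw [support_inv, mem_support_cycleOf_iff]
    exact ⟨SameCycle.rfl, hv⟩
  · rw [cycleFactorsFinset_invertCycleAt hv]
    exact Finset.mem_insert_self _ _

theorem invertCycleAt_involutive (v : α) :
    Function.Involutive (invertCycleAt v : Equiv.Perm α → Equiv.Perm α) := by
  intro σ
  by_cases hv : v ∈ σ.support
  · rw [invertCycleAt, cycleOf_invertCycleAt hv, invertCycleAt]
    simp
  · rw [invertCycleAt_of_notMem hv, invertCycleAt_of_notMem hv]

theorem support_invertCycleAt (v : α) (σ : Equiv.Perm α) :
    (invertCycleAt v σ).support = σ.support := by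
  by_cases hv : v ∈ σ.support
  · have hc := cycleOf_mem_cycleFactorsFinset_iff.mpr hv
    ext x
    rw [mem_support_iff_mem_support_of_mem_cycleFactorsFinset,
      mem_support_iff_mem_support_of_mem_cycleFactorsFinset, cycleFactorsFinset_invertCycleAt hv]
    simp only [Finset.exists_mem_insert, support_inv]
    conv_rhs => rw [← Finset.insert_erase hc]
    simp only [Finset.exists_mem_insert]
  · rw [invertCycleAt_of_notMem hv]

theorem sign_invertCycleAt (v : α) (σ : Equiv.Perm α) : sign (invertCycleAt v σ) = sign σ := by
  simp [invertCycleAt, mul_assoc]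

theorem isCycle_invertCycleAt (v : α) {σ : Equiv.Perm α} :
    (invertCycleAt v σ).IsCycle ↔ σ.IsCycle := by
  have key : ∀ τ : Equiv.Perm α, τ.IsCycle → (invertCycleAt v τ).IsCycle := by
    intro τ hτ
    by_cases hv : v ∈ τ.support
    · rw [invertCycleAt, hτ.cycleOf_eq (mem_support.mp hv)]
      simpa using hτ.inv
    · rwa [invertCycleAt_of_notMem hv]
  refine ⟨fun h => ?_, key σ⟩
  rw [← invertCycleAt_involutive v σ]
  exact key _ h

/-! ### Sums over permutations, averaged over cycle inversion -/

/-- Two functions with the same averages over the orbits of an involution have the same sum. -/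
theorem sum_eq_sum_of_involutive {ι R : Type*} [Fintype ι] [CommRing R] [NoZeroDivisors R]
    [CharZero R] {e : ι → ι} (he : Function.Involutive e) {f g : ι → R}
    (h : ∀ i, f i + f (e i) = g i + g (e i)) : ∑ i, f i = ∑ i, g i := by
  have hs : ∀ φ : ι → R, ∑ i, (φ i + φ (e i)) = 2 * ∑ i, φ i := fun φ => by
    rw [Finset.sum_add_distrib, two_mul]
    congr 1
    exact Function.Bijective.sum_comp he.bijective φ
  apply mul_left_cancel₀ (two_ne_zero (α := R))
  rw [← hs, ← hs]
  exact Finset.sum_congr rfl fun i _ => h i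

/-- A sum over permutations of products of cycle weights depends only on the
sums `w c + w c⁻¹`. -/
theorem sum_prod_cycleFactorsFinset_eq {R : Type*} [CommRing R] [NoZeroDivisors R] [CharZero R]
    (g : Equiv.Perm α → R) (hg : ∀ v σ, g (invertCycleAt v σ) = g σ) (w w' : Equiv.Perm α → R)
    (hw : ∀ σ, g σ ≠ 0 → ∀ c ∈ σ.cycleFactorsFinset, w c + w c⁻¹ = w' c + w' c⁻¹) :
    ∑ σ, g σ * ∏ c ∈ σ.cycleFactorsFinset, w c =
      ∑ σ, g σ * ∏ c ∈ σ.cycleFactorsFinset, w' c := by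
  -- Switch from `w` to `w'` only on cycles meeting `S`, and enlarge `S` point by point: adding `v`
  -- affects at most the cycle through `v`.
  have main : ∀ S : Finset α, ∑ σ, g σ * ∏ c ∈ σ.cycleFactorsFinset, w c =
      ∑ σ, g σ * ∏ c ∈ σ.cycleFactorsFinset, if ∃ v ∈ S, v ∈ c.support then w' c else w c := by
    intro S
    induction S using Finset.induction_on with
    | empty => simp
    | insert v S _ ih =>
      rw [ih]
      refine sum_eq_sum_of_involutive (invertCycleAt_involutive v) fun σ => ?_
      rw [hg]
      by_cases hσ : g σ = 0
      · simp [hσ]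
      by_cases hv : v ∈ σ.support
      · rw [cycleFactorsFinset_invertCycleAt hv]
        have hc := cycleOf_mem_cycleFactorsFinset_iff.mpr hv
        have hvc : v ∈ (σ.cycleOf v).support :=
          mem_support_cycleOf_iff.mpr ⟨SameCycle.rfl, hv⟩
        have hwc := hw σ hσ _ hc
        have hd : ∀ d ∈ σ.cycleFactorsFinset.erase (σ.cycleOf v), v ∉ d.support := by
          intro d hd hvd
          obtain ⟨hne, hmem⟩ := Finset.mem_erase.mp hd
          exact hne (cycle_is_cycleOf hvd hmem)
        simp only [Finset.prod_insert (inv_notMem_erase_cycleFactorsFinset hc),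
          ← Finset.mul_prod_erase _ _ hc, support_inv, Finset.exists_mem_insert, hvc, true_or,
          if_true]
        have hE : (∏ d ∈ σ.cycleFactorsFinset.erase (σ.cycleOf v),
              if v ∈ d.support ∨ ∃ x ∈ S, x ∈ d.support then w' d else w d) =
            ∏ d ∈ σ.cycleFactorsFinset.erase (σ.cycleOf v),
              if ∃ x ∈ S, x ∈ d.support then w' d else w d :=
          Finset.prod_congr rfl fun d hd' => by simp only [hd d hd', false_or]
        rw [hE]
        -- Either the cycle through `v` already met `S`, or the pair of `σ` and its inversion
        -- carries the factor `w c + w c⁻¹`.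
        split_ifs
        · rfl
        · linear_combination (g σ * ∏ d ∈ σ.cycleFactorsFinset.erase (σ.cycleOf v),
              if ∃ x ∈ S, x ∈ d.support then w' d else w d) * hwc
      · rw [invertCycleAt_of_notMem hv]
        have : ∀ c ∈ σ.cycleFactorsFinset, v ∉ c.support := fun c hc hvc =>
          hv (mem_cycleFactorsFinset_support_le hc hvc)
        have hE : (∏ c ∈ σ.cycleFactorsFinset,
              if ∃ x ∈ insert v S, x ∈ c.support then w' c else w c) =
            ∏ c ∈ σ.cycleFactorsFinset, if ∃ x ∈ S, x ∈ c.support then w' c else w c :=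
          Finset.prod_congr rfl fun c hc => by
            simp only [Finset.exists_mem_insert, this c hc, false_or]
        rw [hE]
  rw [main Finset.univ]
  refine Finset.sum_congr rfl fun σ _ => ?_
  congr 1
  refine Finset.prod_congr rfl fun c hc => if_pos ?_
  obtain ⟨x, hx⟩ := (mem_cycleFactorsFinset_iff.mp hc).1.nonempty_support
  exact ⟨x, Finset.mem_univ x, hx⟩

/-! ### Permutation weights and coefficients of the characteristic polynomial -/

/-- The product of the entries of a matrix along the moved points of a permutation. -/
def permWeight {R : Type*} [CommMonoid R] (M : Matrix α α R) (σ : Equiv.Perm α) : R :=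
  ∏ i ∈ σ.support, M i (σ i)

theorem permWeight_eq_prod_cycleFactorsFinset {R : Type*} [CommMonoid R] (M : Matrix α α R)
    (σ : Equiv.Perm α) : permWeight M σ = ∏ c ∈ σ.cycleFactorsFinset, permWeight M c := by
  have hs : σ.support = σ.cycleFactorsFinset.biUnion support := by
    ext x
    simpa using mem_support_iff_mem_support_of_mem_cycleFactorsFinset
  rw [permWeight, hs, Finset.prod_biUnion]
  · refine Finset.prod_congr rfl fun c hc => Finset.prod_congr rfl fun i hi => ?_
    rw [(mem_cycleFactorsFinset_iff.mp hc).2 i hi]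
  · intro c hc d hd hne
    exact (cycleFactorsFinset_pairwise_disjoint σ hc hd hne).disjoint_support

theorem permWeight_inv {R : Type*} [CommRing R] [StarRing R] {M : Matrix α α R}
    (hM : M.IsHermitian) (σ : Equiv.Perm α) : permWeight M σ⁻¹ = star (permWeight M σ) := by
  rw [permWeight, permWeight, support_inv, star_prod]
  symm
  refine Finset.prod_equiv σ (fun i => by simp) fun i _ => ?_
  rw [hM.apply]
  simp

open Polynomial in
-- In the Leibniz expansion each fixed point contributes `X` and each moved point minus an entry.
-- Transposing orients the entries as `M i (σ i)`.
theorem charpoly_coeff_eq_sum_permWeight {R : Type*} [CommRing R] {M : Matrix α α R}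
    (hM : ∀ i, M i i = 0) (m : ℕ) :
    M.charpoly.coeff m = ∑ σ : Equiv.Perm α,
      (if m = Fintype.card α - σ.support.card then
        ((sign σ : ℤ) : R) * (-1) ^ σ.support.card else 0) * permWeight M σ := by
  rw [← Matrix.charpoly_transpose, Matrix.charpoly, Matrix.det_apply', finsetSum_coeff]
  refine Finset.sum_congr rfl fun σ _ => ?_
  have hp : ∏ i, M.transpose.charmatrix (σ i) i =
      C ((-1) ^ σ.support.card * permWeight M σ) * X ^ (Fintype.card α - σ.support.card) := by
    rw [← Finset.prod_mul_prod_compl σ.support]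
    congr 1
    · rw [permWeight, ← Finset.prod_const, ← Finset.prod_mul_distrib, map_prod]
      refine Finset.prod_congr rfl fun i hi => ?_
      rw [Matrix.charmatrix_apply_ne _ _ _ (mem_support.mp hi)]
      simp
    · rw [← Finset.card_compl, ← Finset.prod_const]
      refine Finset.prod_congr rfl fun i hi => ?_
      rw [notMem_support.mp (Finset.mem_compl.mp hi), Matrix.charmatrix_apply_eq]
      simp [hM]
  rw [hp, ← mul_assoc, ← map_intCast (C : R →+* R[X]), ← map_mul, coeff_C_mul_X_pow]
  split_ifs <;> ring

end

/-! ### Graph cycles and cyclic permutations -/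

theorem gain_eq_prod_getVert {n : ℕ} (M : Matrix (Fin n) (Fin n) ℂ) {G : SimpleGraph (Fin n)}
    {u v : Fin n} (W : G.Walk u v) :
    gain M W = ∏ i ∈ Finset.range W.length, M (W.getVert i) (W.getVert (i + 1)) := by
  unfold gain
  induction W with
  | nil => simp
  | cons h p ih =>
    rw [SimpleGraph.Walk.length_cons, Finset.prod_range_succ', SimpleGraph.Walk.darts_cons,
      List.map_cons, List.prod_cons, ih, mul_comm]
    simp

/-- A closed sequence of distinct elements is traversed by a cyclic permutation. -/
theorem exists_isCycle_permWeight_eq {α : Type*} [Fintype α] [DecidableEq α] {k : ℕ} (hk : 2 ≤ k)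
    {f : ℕ → α} (hinj : Set.InjOn f {i | i < k}) (hf : f k = f 0) :
    ∃ c : Equiv.Perm α, c.IsCycle ∧
      ∀ M : Matrix α α ℂ, permWeight M c = ∏ i ∈ Finset.range k, M (f i) (f (i + 1)) := by
  set l := (List.range k).map f with hl
  have hlen : l.length = k := by simp [hl]
  have hnd : l.Nodup := List.nodup_range.map_on fun x hx y hy h =>
    hinj (List.mem_range.mp hx) (List.mem_range.mp hy) h
  have happ : ∀ i < k, l.formPerm (f i) = f (i + 1) := by
    intro i hi
    have h := List.formPerm_apply_getElem l hnd i (hlen ▸ hi)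
    simp only [hl, List.getElem_map, List.getElem_range, List.length_map, List.length_range] at h
    rw [hl, h]
    rcases (show i + 1 < k ∨ i + 1 = k by omega) with h1 | h1
    · rw [Nat.mod_eq_of_lt h1]
    · rw [h1, Nat.mod_self, hf]
  refine ⟨l.formPerm, List.isCycle_formPerm hnd (hlen ▸ hk), fun M => ?_⟩
  have hsupp : l.formPerm.support = (Finset.range k).image f := by
    rw [List.support_formPerm_of_nodup l hnd fun x hx => by
      rw [hx] at hlen; simp at hlen; omega]
    ext x
    simp [hl]
  rw [permWeight, hsupp, Finset.prod_image fun x hx y hy h =>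
    hinj (by simpa using hx) (by simpa using hy) h]
  exact Finset.prod_congr rfl fun i hi => by rw [happ i (Finset.mem_range.mp hi)]

/-- The permutation is chosen before `M`, so that `A` and `B` can be compared along the same cycle.
-/
theorem exists_isCycle_permWeight_eq_gain {n : ℕ} {G : SimpleGraph (Fin n)} {u : Fin n}
    {C : G.Walk u u} (hC : C.IsCycle) :
    ∃ c : Equiv.Perm (Fin n), c.IsCycle ∧ ∀ M, permWeight M c = gain M C := by
  have h3 := hC.three_le_length
  obtain ⟨c, hc, h⟩ := exists_isCycle_permWeight_eq (k := C.length) (f := C.getVert) (by omega)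
    (hC.getVert_injOn'.mono fun i (hi : i < _) => show i ≤ _ by omega) (by simp)
  exact ⟨c, hc, fun M => by rw [h, gain_eq_prod_getVert]⟩

theorem SimpleGraph.exists_walk_getVert_eq {V : Type*} {G : SimpleGraph V} (m : ℕ) (f : ℕ → V)
    (h : ∀ i < m, G.Adj (f i) (f (i + 1))) :
    ∃ W : G.Walk (f 0) (f m), W.length = m ∧ ∀ i ≤ m, W.getVert i = f i := by
  induction m generalizing f with
  | zero => exact ⟨.nil, rfl, fun i hi => by simp [Nat.le_zero.mp hi]⟩
  | succ m ih =>
    obtain ⟨W, hW, hv⟩ := ih (fun i => f (i + 1)) fun i hi => h (i + 1) (by omega)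
    refine ⟨.cons (h 0 (by omega)) W, by simp [hW], fun i hi => ?_⟩
    cases i with
    | zero => simp
    | succ i => simpa using hv i (by omega)

open Equiv.Perm in
/-- A cyclic permutation of length at least three along the edges of a graph is a cycle of the
graph. -/
theorem exists_cycle_gain_eq_permWeight {n : ℕ} {G : SimpleGraph (Fin n)}
    {c : Equiv.Perm (Fin n)} (hc : c.IsCycle) (h3 : 3 ≤ c.support.card)
    (hadj : ∀ i ∈ c.support, G.Adj i (c i)) :
    ∃ (u : Fin n) (C : G.Walk u u), C.IsCycle ∧ ∀ M, gain M C = permWeight M c := by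
  obtain ⟨u, hu⟩ := hc.nonempty_support
  set k := c.support.card with hk
  have hon : c.IsCycleOn c.support := by
    have := hc.isCycleOn
    simpa [coe_support_eq_set_support] using this
  have hmem : ∀ i, (c ^ i) u ∈ c.support := fun i => pow_apply_mem_support.mpr hu
  have hsucc : ∀ i, (c ^ (i + 1)) u = c ((c ^ i) u) := fun i => by rw [pow_succ']; rfl
  have hinj : Set.InjOn (fun i => (c ^ i) u) {i | i < k} := by
    intro i hi j hj h
    exact Nat.ModEq.eq_of_lt_of_lt ((hon.pow_apply_eq_pow_apply hu).mp h) hi hj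
  obtain ⟨W, hlen, hv⟩ := SimpleGraph.exists_walk_getVert_eq (G := G) k (fun i => (c ^ i) u)
    fun i _ => by
      show G.Adj ((c ^ i) u) ((c ^ (i + 1)) u)
      rw [hsucc]
      exact hadj _ (hmem i)
  have hku : (c ^ k) u = u := hon.pow_card_apply hu
  refine ⟨u, W.copy (by simp) hku, ?_, fun M => ?_⟩
  · rw [SimpleGraph.Walk.isCycle_iff_isPath_tail_and_le_length]
    refine ⟨?_, by simpa [hlen] using h3⟩
    rw [← SimpleGraph.Walk.IsPath.getVert_injOn_iff]
    intro i hi j hj h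
    have hlt : (W.copy (by simp : (c ^ 0) u = u) hku).tail.length + 1 = k := by
      rw [SimpleGraph.Walk.length_tail_add_one, SimpleGraph.Walk.length_copy, hlen]
      rw [SimpleGraph.Walk.not_nil_iff_lt_length, SimpleGraph.Walk.length_copy, hlen]
      omega
    simp only [Set.mem_ofPred_eq] at hi hj
    rw [SimpleGraph.Walk.getVert_tail, SimpleGraph.Walk.getVert_tail,
      SimpleGraph.Walk.getVert_copy, SimpleGraph.Walk.getVert_copy, hv _ (by omega),
      hv _ (by omega), hsucc, hsucc] at h
    -- The tail ends at `(c ^ k) u = u`; cancelling one `c` brings the exponents back into `0, …, k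
    -- - 1`.
    exact hinj (show i < k by omega) (show j < k by omega) (c.injective h)
  · rw [gain_eq_prod_getVert, SimpleGraph.Walk.length_copy, hlen, permWeight]
    refine Finset.prod_bij (fun i _ => (c ^ i) u) (fun i _ => hmem i)
      (fun i hi j hj h => hinj (Finset.mem_range.mp hi) (Finset.mem_range.mp hj) h)
      (fun b hb => ?_) fun i hi => ?_
    · obtain ⟨i, hi, h⟩ := hon.exists_pow_eq hu hb
      exact ⟨i, Finset.mem_range.mpr hi, h⟩
    · have := Finset.mem_range.mp hi
      rw [SimpleGraph.Walk.getVert_copy, SimpleGraph.Walk.getVert_copy, hv _ (by omega),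
        hv _ (by omega), hsucc]

theorem IsGainSet.norm_eq_one {Γ : Set ℂ} (hΓ : IsGainSet Γ) {z : ℂ} (hz : z ∈ Γ) (h0 : z ≠ 0) :
    ‖z‖ = 1 := by
  obtain ⟨-, U, hU⟩ := hΓ
  have : z ∈ Γ \ {0} := ⟨hz, h0⟩
  rw [hU] at this
  obtain ⟨w, -, rfl⟩ := this
  exact Circle.norm_coe w

/-- Both weights of a cyclic permutation agree, or are the gains of a common cycle. -/
theorem permWeight_eq_or_exists_cycle {n : ℕ} {Γ : Set ℂ} (hΓ : IsGainSet Γ)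
    {A B : hermitianGain n Γ} {G : SimpleGraph (Fin n)} (hA : graphOf A = G) (hB : graphOf B = G)
    {c : Equiv.Perm (Fin n)} (hc : c.IsCycle) :
    permWeight A.1 c = permWeight B.1 c ∨
      ∃ (u : Fin n) (C : G.Walk u u), C.IsCycle ∧
        permWeight A.1 c = gain A.1 C ∧ permWeight B.1 c = gain B.1 C := by
  by_cases hadj : ∀ i ∈ c.support, G.Adj i (c i)
  · rcases (show c.support.card = 2 ∨ 3 ≤ c.support.card by
      have := hc.two_le_card_support; omega) with h2 | h3
    · left
      -- A transposition has weight `a * conj a = ‖a‖ ^ 2`, which is `1` on an edge.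
      have key : ∀ M : hermitianGain n Γ, graphOf M = G → permWeight M.1 c = 1 := by
        intro M hM
        obtain ⟨x, y, hxy, rfl⟩ := Equiv.Perm.card_support_eq_two.mp h2
        have hne : M.1 x y ≠ 0 := by
          have := hadj x (by simp [hxy])
          rw [← hM, Equiv.swap_apply_left] at this
          exact this
        rw [permWeight, Equiv.Perm.support_swap hxy, Finset.prod_pair hxy, Equiv.swap_apply_left,
          Equiv.swap_apply_right, ← M.2.1.apply y x, Complex.star_def, Complex.mul_conj,
          Complex.normSq_eq_norm_sq, hΓ.norm_eq_one (M.2.2.1 x y) hne]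
        simp
      rw [key A hA, key B hB]
    · right
      obtain ⟨u, C, hC, h⟩ := exists_cycle_gain_eq_permWeight hc h3 hadj
      exact ⟨u, C, hC, (h _).symm, (h _).symm⟩
  · left
    push Not at hadj
    obtain ⟨i, hi, hn⟩ := hadj
    have key : ∀ M : hermitianGain n Γ, graphOf M = G → permWeight M.1 c = 0 := by
      intro M hM
      refine Finset.prod_eq_zero hi ?_
      rw [← hM] at hn
      exact not_not.mp hn
    rw [key A hA, key B hB]

/-! ### Characteristic polynomials and real parts of cycle weights -/

theorem cospectral_iff_charpoly_eq {n : ℕ} (A B : Matrix (Fin n) (Fin n) ℂ) :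
    Cospectral A B ↔ A.charpoly = B.charpoly := by
  refine ⟨fun h => ?_, fun h => by rw [Cospectral, spectrumMultiset, h, spectrumMultiset]⟩
  rw [(IsAlgClosed.splits A.charpoly).eq_prod_roots_of_monic A.charpoly_monic,
    (IsAlgClosed.splits B.charpoly).eq_prod_roots_of_monic B.charpoly_monic]
  exact congrArg (fun s : Multiset ℂ => (s.map fun a => Polynomial.X - Polynomial.C a).prod) h

theorem permWeight_add_inv_eq {α : Type*} [Fintype α] [DecidableEq α] {A B : Matrix α α ℂ}
    (hA : A.IsHermitian) (hB : B.IsHermitian) {c : Equiv.Perm α}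
    (h : (permWeight A c).re = (permWeight B c).re) :
    permWeight A c + permWeight A c⁻¹ = permWeight B c + permWeight B c⁻¹ := by
  rw [permWeight_inv hA, permWeight_inv hB, Complex.star_def, Complex.add_conj,
    Complex.add_conj, h]

theorem charpoly_eq_of_re_permWeight_eq {α : Type*} [Fintype α] [DecidableEq α]
    {A B : Matrix α α ℂ} (hA : A.IsHermitian) (hB : B.IsHermitian) (hA0 : ∀ i, A i i = 0)
    (hB0 : ∀ i, B i i = 0)
    (h : ∀ c : Equiv.Perm α, c.IsCycle → (permWeight A c).re = (permWeight B c).re) :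
    A.charpoly = B.charpoly := by
  ext m
  rw [charpoly_coeff_eq_sum_permWeight hA0, charpoly_coeff_eq_sum_permWeight hB0]
  have hfac := sum_prod_cycleFactorsFinset_eq (fun σ : Equiv.Perm α =>
      if m = Fintype.card α - σ.support.card then
        ((Equiv.Perm.sign σ : ℤ) : ℂ) * (-1) ^ σ.support.card else 0)
    (fun v σ => by rw [support_invertCycleAt, sign_invertCycleAt])
    (permWeight A) (permWeight B) fun σ _ c hc =>
      permWeight_add_inv_eq hA hB (h c (Equiv.Perm.mem_cycleFactorsFinset_iff.mp hc).1)
  simpa only [← permWeight_eq_prod_cycleFactorsFinset] using hfac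

open Equiv.Perm in
theorem sum_isCycle_permWeight_eq {α : Type*} [Fintype α] [DecidableEq α]
    [DecidablePred (IsCycle : Equiv.Perm α → Prop)]
    {A B : Matrix α α ℂ} (hA : A.IsHermitian) (hB : B.IsHermitian) (hA0 : ∀ i, A i i = 0)
    (hB0 : ∀ i, B i i = 0) (hchar : A.charpoly = B.charpoly) {k : ℕ}
    (h : ∀ c : Equiv.Perm α, c.IsCycle → c.support.card < k →
      (permWeight A c).re = (permWeight B c).re) :
    ∑ c : Equiv.Perm α with c.IsCycle ∧ c.support.card = k, permWeight A c =
      ∑ c : Equiv.Perm α with c.IsCycle ∧ c.support.card = k, permWeight B c := by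
  -- For `k > n` the truncated `n - k` would be the index `0` that belongs to `k = n`, so this case
  -- is set apart.
  rcases lt_or_ge (Fintype.card α) k with hkn | hkn
  · have : (Finset.univ.filter fun c : Equiv.Perm α => c.IsCycle ∧ c.support.card = k) = ∅ :=
      Finset.filter_eq_empty_iff.mpr fun c _ hc => by
        have := c.support.card_le_univ
        omega
    simp only [this, Finset.sum_empty]
  have hcard : ∀ σ : Equiv.Perm α,
      Fintype.card α - k = Fintype.card α - σ.support.card ↔ σ.support.card = k := fun σ => by
    have := σ.support.card_le_univ
    omega
  have split : ∀ {M : Matrix α α ℂ}, (∀ i, M i i = 0) →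
      M.charpoly.coeff (Fintype.card α - k) =
        (∑ σ : Equiv.Perm α, (if σ.support.card = k ∧ ¬ σ.IsCycle then
          ((sign σ : ℤ) : ℂ) * (-1) ^ k else 0) * ∏ c ∈ σ.cycleFactorsFinset, permWeight M c) -
        ∑ c : Equiv.Perm α with c.IsCycle ∧ c.support.card = k, permWeight M c := by
    intro M hM
    rw [charpoly_coeff_eq_sum_permWeight hM, Finset.sum_filter, ← Finset.sum_sub_distrib]
    refine Finset.sum_congr rfl fun σ _ => ?_
    rw [← permWeight_eq_prod_cycleFactorsFinset]
    simp only [hcard]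
    by_cases hk : σ.support.card = k <;> by_cases hc : σ.IsCycle
    -- A `k`-cycle has sign `-(-1) ^ k`, so its total coefficient is `-1`.
    · simp only [hk, hc, hc.sign, not_true_eq_false, and_false, and_self, if_true, if_false]
      push_cast
      rw [neg_mul, ← mul_pow]
      simp
    all_goals simp [hk, hc]
  have hcoeff := congrArg (fun p => p.coeff (Fintype.card α - k)) hchar
  simp only [split hA0, split hB0] at hcoeff
  have hrest := sum_prod_cycleFactorsFinset_eq
    (fun σ : Equiv.Perm α => if σ.support.card = k ∧ ¬ σ.IsCycle then
      ((sign σ : ℤ) : ℂ) * (-1) ^ k else 0)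
    (fun v σ => by simp only [support_invertCycleAt, sign_invertCycleAt, isCycle_invertCycleAt])
    (permWeight A) (permWeight B) fun σ hσ c hc => by
      have hσ' : σ.support.card = k ∧ ¬ σ.IsCycle := by
        by_contra hn
        exact hσ (if_neg hn)
      have hcyc := (mem_cycleFactorsFinset_iff.mp hc).1
      have hle := mem_cycleFactorsFinset_support_le hc
      refine permWeight_add_inv_eq hA hB (h c hcyc ?_)
      rw [← hσ'.1]
      refine Finset.card_lt_card (hle.lt_of_ne fun he => hσ'.2 ?_)
      -- A cycle factor with full support would be `σ` itself, which is not a cycle here.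
      have : c = σ := by
        ext1 x
        by_cases hx : x ∈ c.support
        · exact (mem_cycleFactorsFinset_iff.mp hc).2 x hx
        · rw [notMem_support.mp hx, notMem_support.mp (he ▸ hx)]
      exact this ▸ hcyc
  rw [hrest] at hcoeff
  exact sub_right_injective hcoeff

/-- If the real parts of the cycle weights of `A` are at most those of `B`, then equality of the
characteristic polynomials forces them to agree. -/
theorem re_permWeight_eq_of_charpoly_eq {α : Type*} [Fintype α] [DecidableEq α]
    {A B : Matrix α α ℂ} (hA : A.IsHermitian) (hB : B.IsHermitian) (hA0 : ∀ i, A i i = 0)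
    (hB0 : ∀ i, B i i = 0)
    (hle : ∀ c : Equiv.Perm α, c.IsCycle → (permWeight A c).re ≤ (permWeight B c).re)
    (hchar : A.charpoly = B.charpoly) :
    ∀ c : Equiv.Perm α, c.IsCycle → (permWeight A c).re = (permWeight B c).re := by
  classical
  suffices H : ∀ k, ∀ c : Equiv.Perm α, c.IsCycle → c.support.card = k →
      (permWeight A c).re = (permWeight B c).re from fun c hc => H _ c hc rfl
  intro k
  induction k using Nat.strong_induction_on with
  | _ k ih =>
    have hsum := congrArg Complex.re (sum_isCycle_permWeight_eq hA hB hA0 hB0 hchar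
      fun c hc hk => ih _ hk c hc rfl)
    rw [Complex.re_sum, Complex.re_sum, Finset.sum_eq_sum_iff_of_le
      fun c hc => hle c (Finset.mem_filter.mp hc).2.1] at hsum
    exact fun c hc hk => hsum c (Finset.mem_filter.mpr ⟨Finset.mem_univ c, hc, hk⟩)

/-! ### Cospectrality and real gains -/

theorem cospectral_iff_of_realGain_le {n : ℕ} {Γ : Set ℂ} (hΓ : IsGainSet Γ)
    {A B : hermitianGain n Γ} {G : SimpleGraph (Fin n)} (hA : graphOf A = G) (hB : graphOf B = G)
    (hle : ∀ (u : Fin n) (C : G.Walk u u), C.IsCycle → realGain A.1 C ≤ realGain B.1 C) :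
    Cospectral A.1 B.1 ↔
      ∀ (u : Fin n) (C : G.Walk u u), C.IsCycle → realGain A.1 C = realGain B.1 C := by
  rw [cospectral_iff_charpoly_eq]
  constructor
  · intro hchar u C hC
    obtain ⟨c, hc, h⟩ := exists_isCycle_permWeight_eq_gain hC
    rw [realGain, realGain, ← h, ← h]
    refine re_permWeight_eq_of_charpoly_eq A.2.1 B.2.1 A.2.2.2 B.2.2.2 (fun d hd => ?_) hchar c hc
    rcases permWeight_eq_or_exists_cycle hΓ hA hB hd with he | ⟨v, D, hD, h1, h2⟩
    · rw [he]
    · rw [h1, h2]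
      exact hle v D hD
  · intro heq
    refine charpoly_eq_of_re_permWeight_eq A.2.1 B.2.1 A.2.2.2 B.2.2.2 fun d hd => ?_
    rcases permWeight_eq_or_exists_cycle hΓ hA hB hd with he | ⟨v, D, hD, h1, h2⟩
    · rw [he]
    · rw [h1, h2]
      exact heq v D hD

theorem realGain_le_one {n : ℕ} {Γ : Set ℂ} (hΓ : IsGainSet Γ) (B : hermitianGain n Γ)
    {G : SimpleGraph (Fin n)} {u v : Fin n} (W : G.Walk u v) : realGain B.1 W ≤ 1 := by
  refine (Complex.re_le_norm _).trans ?_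
  rw [gain_eq_prod_getVert, norm_prod]
  refine Finset.prod_le_one (fun i _ => norm_nonneg _) fun i _ => ?_
  by_cases h0 : B.1 (W.getVert i) (W.getVert (i + 1)) = 0
  · simp [h0]
  · exact (hΓ.norm_eq_one (B.2.2.1 _ _) h0).le

theorem mainTheorem4 (n : ℕ) (Γ : Set ℂ) (hΓ : IsGainSet Γ) (A B : hermitianGain n Γ)
    (G : SimpleGraph (Fin n)) (hA : graphOf A = G) (hB : graphOf B = G) :
    ((∀ (u : Fin n) (C : G.Walk u u), C.IsCycle → realGain A.1 C ≤ realGain B.1 C) →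
      (Cospectral A.1 B.1 ↔
        ∀ (u : Fin n) (C : G.Walk u u), C.IsCycle → realGain A.1 C = realGain B.1 C)) ∧
    (IsBalanced A →
      (Cospectral A.1 B.1 ↔
        ∀ (u : Fin n) (C : G.Walk u u), C.IsCycle → realGain A.1 C = realGain B.1 C)) := by
  refine ⟨cospectral_iff_of_realGain_le hΓ hA hB, fun hbal => ?_⟩
  -- Balance makes every real gain of `A` the largest possible, so the first part applies with `A`
  -- and `B` exchanged.
  have h := cospectral_iff_of_realGain_le hΓ hB hA fun u C hC => by
    have h1 : realGain A.1 C = 1 := by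
      subst hA
      rw [realGain, hbal u C hC, Complex.one_re]
    rw [h1]
    exact realGain_le_one hΓ B C
  rw [show Cospectral A.1 B.1 ↔ Cospectral B.1 A.1 from eq_comm, h]
  simp only [eq_comm]
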